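/- Let $F$ be a finite non-bipartite graph with chromatic number $\chi(F) = r$. Let $\mathcal{G}_F$ be the family of all (infinite) graphs $G$ with vertex set $\mathbb{N} = \{1, 2, 3, \dots\}$ that do not contain $F$ as a (not necessarily induced) subgraph, and for such a graph $G$ let $e(G_n)$ be the number of edges of the subgraph $G_n$ of $G$ induced by the vertices $\{1, 2, \dots, n\}$. Then \[ \sup_{G \in \mathcal{G}_F} \left\{ \liminf_{n \rightarrow \infty} \frac{e(G_n)}{n^{2}} \right\} = \sup_{G \in \mathcal{G}_F} \left\{ \limsup_{n \rightarrow \infty} \frac{e(G_n)}{n^{2}} \right\} = \frac{1}{2} \left( 1 - \frac{1}{r-1} \right). \] -/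

import Mathlib

open Filter

namespace InfiniteTuran

/-- The subgraph `G_n` of `G` induced by the vertices `1, 2, …, n`, for a graph `G` whose vertex
set is the set `ℕ+` of positive integers. -/
def initialGraph (G : SimpleGraph ℕ+) (n : ℕ) : SimpleGraph {v : ℕ+ | (v : ℕ) ≤ n} :=
  G.induce {v : ℕ+ | (v : ℕ) ≤ n}

/-- The number `e(G_n)` of edges of `G_n`. -/
noncomputable def edgeCount (G : SimpleGraph ℕ+) (n : ℕ) : ℕ :=
  (initialGraph G n).edgeSet.ncard

/-- The ratio `e(G_n) / n ^ 2`, as an extended real number. -/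
noncomputable def edgeRatio (G : SimpleGraph ℕ+) (n : ℕ) : EReal :=
  (((edgeCount G n : ℝ) / (n : ℝ) ^ 2 : ℝ) : EReal)

/-- The family of all graphs on the positive integers that do not contain `F` as a
(not necessarily induced) subgraph. -/
def freeGraphs {V : Type*} (F : SimpleGraph V) : Set (SimpleGraph ℕ+) :=
  {G | F.Free G}

end InfiniteTuran

namespace SimpleGraph

/-! Every initial segment of an `F`-free graph is `F`-free, so the upper bound is
Erdős–Stone–Simonovits, derived from its minimum-degree form by deleting vertices. For the lower
bound, the residue classes modulo `χ(F) - 1` give one infinite graph, not containing `F`, whose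
initial segments are all Turán graphs; it attains both suprema. In the lemmas `r` stands for `χ(F) -
1`. -/

/-- A graph with an `(r + 1)`-colouring is contained in every large graph of minimal degree at
least `(1 - 1 / r + ε) * n`. -/
theorem Colorable.eventually_isContained_of_minDegree {V : Type*} [Finite V] {F : SimpleGraph V}
    {r : ℕ} (hF : F.Colorable (r + 1)) {ε : ℝ} (hε : 0 < ε) :
    ∀ᶠ n in atTop, ∀ {G : SimpleGraph (Fin n)} [DecidableRel G.Adj],
      G.minDegree ≥ (1 - 1 / r + ε) * n → F ⊑ G := by
  classical
  cases nonempty_fintype V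
  filter_upwards [eventually_completeEquipartiteGraph_isContained_of_minDegree hε r
    (Fintype.card V)] with n hn G _ hG
  exact (isContained_completeEquipartiteGraph_of_colorable hF.some _
    fun _ ↦ Fintype.card_subtype_le _).trans (hn hG)

/-- Deleting a vertex of minimum degree keeps the graph `F`-free, and that degree is small, since
otherwise `F` would appear. -/
theorem Colorable.eventually_extremalNumber_succ_le {V : Type*} [Finite V] {F : SimpleGraph V}
    {r : ℕ} (hF : F.Colorable (r + 1)) {ε : ℝ} (hε : 0 < ε) :
    ∀ᶠ n : ℕ in atTop, (extremalNumber (n + 1) F : ℝ)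
      ≤ extremalNumber n F + (1 - 1 / r + ε) * (n + 1) := by
  have hr : (0 : ℝ) ≤ 1 - 1 / r := by
    simpa using Nat.cast_inv_le_one r
  filter_upwards [(tendsto_add_atTop_nat 1).eventually
    (hF.eventually_isContained_of_minDegree hε)] with n hn
  have key := (extremalNumber_le_iff_of_nonneg (V := Fin (n + 1)) F
    (m := (extremalNumber n F : ℝ) + (1 - 1 / r + ε) * (n + 1)) (by positivity)).2
  rw [Fintype.card_fin] at key
  refine key fun G _ hG ↦ ?_
  have hδ : (G.minDegree : ℝ) < (1 - 1 / r + ε) * (n + 1) := by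
    by_contra! h
    exact hG (hn (by exact_mod_cast h))
  obtain ⟨v, hv⟩ := G.exists_minimal_degree_vertex
  have hdel := card_edgeFinset_deleteIncidenceSet_le_extremalNumber hG v
  rw [card_edgeFinset_deleteIncidenceSet, Fintype.card_fin, Nat.add_sub_cancel,
    Nat.sub_le_iff_le_add, ← hv] at hdel
  have : (G.edgeFinset.card : ℝ) ≤ extremalNumber n F + G.minDegree := by exact_mod_cast hdel
  linarith

/-- The edge version of the **Erdős-Stone-Simonovits theorem**, upper bound. -/
theorem Colorable.exists_eventually_extremalNumber_le {V : Type*} [Finite V] {F : SimpleGraph V}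
    {r : ℕ} (hF : F.Colorable (r + 1)) {ε : ℝ} (hε : 0 < ε) :
    ∃ C : ℝ, ∀ᶠ n : ℕ in atTop, (extremalNumber n F : ℝ)
      ≤ C + (1 - 1 / r + ε) * (n * (n + 1) / 2) := by
  have hr : (0 : ℝ) ≤ 1 - 1 / r := by
    simpa using Nat.cast_inv_le_one r
  obtain ⟨N, hN⟩ := eventually_atTop.1 (hF.eventually_extremalNumber_succ_le hε)
  -- `C` absorbs the range below `N`; the later increments are dominated by `1 + ⋯ + n`.
  refine ⟨extremalNumber N F, eventually_atTop.2 ⟨N, fun n hn ↦ ?_⟩⟩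
  induction n, hn using Nat.le_induction with
  | base => exact le_add_of_nonneg_right (by positivity)
  | succ n hn ih =>
    have := hN n hn
    push_cast
    linarith

/-- The number of edges of the Turán graph is at least `(1 - 1 / r) * n ^ 2 / 2`, up to a bounded
error. -/
theorem le_card_edgeFinset_turanGraph {r : ℕ} (hr : 0 < r) (n : ℕ) :
    ((n : ℝ) ^ 2 - r ^ 2) * (1 - 1 / r) / 2 - 1 ≤ ((turanGraph n r).edgeFinset.card : ℝ) := by
  rw [card_edgeFinset_turanGraph]
  set m := (n ^ 2 - (n % r) ^ 2) * (r - 1) with hm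
  have hmod : ((n % r : ℕ) : ℝ) ≤ r := by exact_mod_cast (Nat.mod_lt n hr).le
  have hr' : (0 : ℝ) < r := by exact_mod_cast hr
  have hr1 : (1 : ℝ) ≤ r := by exact_mod_cast hr
  have hmr : (m : ℝ) = ((n : ℝ) ^ 2 - ((n % r : ℕ) : ℝ) ^ 2) * (r - 1) := by
    rw [hm, Nat.cast_mul, Nat.cast_sub (Nat.pow_le_pow_left (Nat.mod_le n r) 2),
      Nat.cast_sub (Nat.one_le_iff_ne_zero.2 hr.ne')]
    push_cast
    ring
  have hdiv : (m : ℝ) / (2 * r : ℕ) - 1 ≤ ((m / (2 * r) : ℕ) : ℝ) := by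
    have := Nat.lt_floor_add_one ((m : ℝ) / (2 * r : ℕ))
    rw [Nat.floor_div_eq_div] at this
    linarith
  have hle : ((n : ℝ) ^ 2 - r ^ 2) * (1 - 1 / r) / 2 ≤ (m : ℝ) / (2 * r : ℕ) := by
    have h : ((n : ℝ) ^ 2 - r ^ 2) * (1 - 1 / r) / 2
        = ((n : ℝ) ^ 2 - r ^ 2) * (r - 1) / (2 * r : ℕ) := by
      push_cast
      field_simp
    rw [h, hmr]
    gcongr
  push_cast
  have : (0 : ℝ) ≤ ((n % r).choose 2 : ℕ) := Nat.cast_nonneg _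
  linarith

end SimpleGraph

namespace InfiniteTuran

open SimpleGraph Topology

/-- The vertices `1, …, n` of a graph on the positive integers, numbered from `0`. -/
def initialVerticesEquiv (n : ℕ) : {v : ℕ+ | (v : ℕ) ≤ n} ≃ Fin n where
  toFun v := ⟨v.1.natPred, by have := v.1.natPred_add_one; have h : (v.1 : ℕ) ≤ n := v.2; omega⟩
  invFun i := ⟨i.1.succPNat, by simp⟩
  left_inv v := by simp
  right_inv i := by simp

theorem edgeCount_eq_card_edgeFinset {G : SimpleGraph ℕ+} {n : ℕ} {W : Type*} [Fintype W]
    {H : SimpleGraph W} [DecidableRel H.Adj] (e : initialGraph G n ≃g H) :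
    edgeCount G n = H.edgeFinset.card := by
  rw [edgeCount, ← Nat.card_coe_set_eq, Nat.card_congr e.mapEdgeSet, Nat.card_coe_set_eq,
    ← coe_edgeFinset, Set.ncard_coe_finset]

theorem edgeCount_le_extremalNumber {V : Type*} {F : SimpleGraph V} {G : SimpleGraph ℕ+}
    (hG : F.Free G) (n : ℕ) : edgeCount G n ≤ extremalNumber n F := by
  classical
  let e : initialGraph G n ≃g (initialGraph G n).map (initialVerticesEquiv n).toEmbedding :=
    Iso.map (initialVerticesEquiv n) _
  rw [edgeCount_eq_card_edgeFinset e]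
  have hfree : F.Free ((initialGraph G n).map (initialVerticesEquiv n).toEmbedding) :=
    fun h ↦ hG ((h.trans e.symm.isContained).trans ⟨Copy.induce G _⟩)
  simpa using card_edgeFinset_le_extremalNumber hfree

theorem limsup_edgeRatio_le {V : Type*} [Finite V] {F : SimpleGraph V} {r : ℕ}
    (hF : F.Colorable (r + 1)) {G : SimpleGraph ℕ+} (hG : F.Free G) :
    limsup (edgeRatio G) atTop ≤ (((1 / 2 : ℝ) * (1 - 1 / r) : ℝ) : EReal) := by
  refine EReal.le_of_forall_lt_iff_le.1 fun x hx ↦ ?_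
  rw [EReal.coe_lt_coe_iff] at hx
  -- `ε` is twice the gap because it gets multiplied by `n * (n + 1) / 2`.
  obtain ⟨ε, hε, hεx⟩ : ∃ ε > 0, (1 / 2 : ℝ) * (1 - 1 / r) + ε / 2 = x :=
    ⟨2 * (x - (1 / 2 : ℝ) * (1 - 1 / r)), by linarith, by ring⟩
  obtain ⟨C, hC⟩ := hF.exists_eventually_extremalNumber_le hε
  have hinv := tendsto_inv_atTop_nhds_zero_nat (𝕜 := ℝ)
  have hlim : Tendsto (fun n : ℕ ↦ C * ((n : ℝ)⁻¹ * (n : ℝ)⁻¹)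
      + (1 - 1 / r + ε) * ((1 + (n : ℝ)⁻¹) / 2)) atTop (𝓝 x) := by
    convert ((hinv.mul hinv).const_mul C).add
      (((hinv.const_add 1).div_const 2).const_mul (1 - 1 / r + ε)) using 2
    rw [← hεx]
    ring
  have hlim' := (continuous_coe_real_ereal.tendsto x).comp hlim
  rw [← hlim'.limsup_eq]
  refine limsup_le_limsup ?_
  filter_upwards [hC, eventually_gt_atTop 0] with n hn hpos
  have hn0 : (0 : ℝ) < n := by exact_mod_cast hpos
  rw [edgeRatio, Function.comp_apply, EReal.coe_le_coe_iff, div_le_iff₀ (by positivity)]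
  have h : (edgeCount G n : ℝ) ≤ extremalNumber n F := by
    exact_mod_cast edgeCount_le_extremalNumber hG n
  refine (h.trans hn).trans_eq ?_
  field_simp

/-- The infinite Turán graph: the complete `r`-partite graph on the positive integers whose parts
are the residue classes modulo `r`. -/
def turanGraphPNat (r : ℕ) : SimpleGraph ℕ+ where
  Adj v w := v.natPred % r ≠ w.natPred % r

theorem turanGraphPNat_colorable {r : ℕ} (hr : 0 < r) : (turanGraphPNat r).Colorable r :=
  ⟨Coloring.mk (fun v ↦ ⟨v.natPred % r, Nat.mod_lt _ hr⟩) fun h h' ↦ h (Fin.mk.inj_iff.1 h')⟩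

theorem edgeCount_turanGraphPNat (r n : ℕ) :
    edgeCount (turanGraphPNat r) n = (turanGraph n r).edgeFinset.card :=
  -- Both adjacencies compare residues of the index counted from `0`, hence `Iff.rfl`.
  edgeCount_eq_card_edgeFinset ⟨initialVerticesEquiv n, Iff.rfl⟩

theorem le_liminf_edgeRatio_turanGraphPNat {r : ℕ} (hr : 0 < r) :
    (((1 / 2 : ℝ) * (1 - 1 / r) : ℝ) : EReal) ≤ liminf (edgeRatio (turanGraphPNat r)) atTop := by
  have hinv := tendsto_inv_atTop_nhds_zero_nat (𝕜 := ℝ)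
  have hlim : Tendsto (fun n : ℕ ↦ (1 - r ^ 2 * ((n : ℝ)⁻¹ * (n : ℝ)⁻¹)) * (1 - 1 / r) / 2
      - (n : ℝ)⁻¹ * (n : ℝ)⁻¹) atTop (𝓝 ((1 / 2 : ℝ) * (1 - 1 / r))) := by
    convert (((((hinv.mul hinv).const_mul ((r : ℝ) ^ 2)).const_sub 1).mul_const
      (1 - 1 / (r : ℝ))).div_const 2).sub (hinv.mul hinv) using 2
    ring
  have hlim' := (continuous_coe_real_ereal.tendsto _).comp hlim
  rw [← hlim'.liminf_eq]
  refine liminf_le_liminf ?_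
  filter_upwards [eventually_gt_atTop 0] with n hpos
  have hn0 : (0 : ℝ) < n := by exact_mod_cast hpos
  have hr0 : (0 : ℝ) < r := by exact_mod_cast hr
  rw [edgeRatio, Function.comp_apply, EReal.coe_le_coe_iff, le_div_iff₀ (by positivity),
    edgeCount_turanGraphPNat]
  refine Eq.trans_le ?_ (le_card_edgeFinset_turanGraph hr n)
  field_simp

theorem turanGraphPNat_mem_freeGraphs {V : Type*} {F : SimpleGraph V} {r : ℕ} (hr : 0 < r)
    (hF : ¬ F.Colorable r) : turanGraphPNat r ∈ freeGraphs F :=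
  fun ⟨f⟩ ↦ hF ((turanGraphPNat_colorable hr).of_hom f.toHom)

end InfiniteTuran

theorem proposition1 {V : Type*} [Finite V] (F : SimpleGraph V) (hF : ¬ F.IsBipartite)
    (r : ℕ) (hr : F.chromaticNumber = (r : ℕ∞)) :
    (⨆ G ∈ InfiniteTuran.freeGraphs F, liminf (InfiniteTuran.edgeRatio G) atTop)
        = (((1 / 2 : ℝ) * (1 - 1 / ((r : ℝ) - 1)) : ℝ) : EReal) ∧
    (⨆ G ∈ InfiniteTuran.freeGraphs F, limsup (InfiniteTuran.edgeRatio G) atTop)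
        = (((1 / 2 : ℝ) * (1 - 1 / ((r : ℝ) - 1)) : ℝ) : EReal) := by
  have hcol (m : ℕ) : F.Colorable m ↔ r ≤ m := by
    rw [← SimpleGraph.chromaticNumber_le_iff_colorable, hr, Nat.cast_le]
  have hr2 : 2 < r := by
    by_contra! h
    exact hF ((hcol 2).2 h)
  obtain ⟨k, rfl⟩ : ∃ k, r = k + 1 := ⟨r - 1, by omega⟩
  have hk : 0 < k := by omega
  have hmem := InfiniteTuran.turanGraphPNat_mem_freeGraphs hk (F := F) (by simp [hcol])
  have hlow := InfiniteTuran.le_liminf_edgeRatio_turanGraphPNat hk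
  have hup (G) (hG : G ∈ InfiniteTuran.freeGraphs F) :=
    InfiniteTuran.limsup_edgeRatio_le ((hcol (k + 1)).2 le_rfl) hG
  rw [show ((k + 1 : ℕ) : ℝ) - 1 = k by push_cast; ring]
  exact ⟨le_antisymm (iSup₂_le fun G hG ↦ (liminf_le_limsup).trans (hup G hG))
      (hlow.trans (le_iSup₂_of_le _ hmem le_rfl)),
    le_antisymm (iSup₂_le hup)
      ((hlow.trans liminf_le_limsup).trans (le_iSup₂_of_le _ hmem le_rfl))⟩
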